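/- Let $\mathcal{A}=(\mathcal{P},\mathcal{L},\mathcal{I})$ be a Desargues affine plane, that is, an incidence structure of points and lines such that - any two distinct points lie on exactly one line; - for every point $P$ and every line $\ell$ with $P\notin\ell$ there is exactly one line through $P$ that has no common point with $\ell$; - there are three non-collinear points; - (Desargues' axiom) if $a,b,c$ are pairwise distinct lines that are either parallel or concurrent in a point $S$, and $A\neq A'$ are points of $a$, $B\neq B'$ points of $b$, $C\neq C'$ points of $c$ (all six different from $S$ in the concurrent case) with $AB\parallel A'B'$ and $BC\parallel B'C'$, then $AC\parallel A'C'$. Here two lines are called parallel if they are equal or have no common point. Fix two distinct points $O,I$ and let $\ell^{OI}$ be the line through them. For $A,B\in\ell^{OI}$ the points $A+B$ and $A\cdot B$ of $\ell^{OI}$ are constructed with an auxiliary point $B_1\notin\ell^{OI}$ as follows. - Sum: let $P_1$ be the intersection of the parallel to $\ell^{OI}$ through $B_1$ and the parallel to $OB_1$ through $A$; then $A+B$ is the intersection of $\ell^{OI}$ with the parallel to $BB_1$ through $P_1$. - Product: let $P_1$ be the intersection of the parallel to $IB_1$ through $A$ and the line $OB_1$; then $A\cdot B$ is the intersection of $\ell^{OI}$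 with the parallel to $BB_1$ through $P_1$. Denote by $-A$ the point of $\ell^{OI}$ with $A+(-A)=O$, put $A-B=A+(-B)$, and for $A\neq O$ denote by $A^{-1}$ the point of $\ell^{OI}$ with $A\cdot A^{-1}=I$. For points $A,B,C$ of $\ell^{OI}$ with $B\ne C$ let $r(A,B;C)=(B-C)^{-1}(A-C)$ be their ratio. **Theorem.** Let $B,C\in\ell^{OI}$ with $B\neq C$. Then the ratio map $$r_{BC}:\ell^{OI}\to\ell^{OI},\qquad r_{BC}(X)=r(X,B;C)=(B-C)^{-1}(X-C),$$ is a bijection. Its (two-sided) inverse is the map $R\mapsto (B-C)R+C$. Moreover, for all $X\in\ell^{OI}$, $$r_{BC}(X)=M\cdot X+N\qquad\text{with } M=(B-C)^{-1},\quad N=(C-B)^{-1}C .$$ -/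

import Mathlib

/-- Two lines are parallel if they are equal or have no common point. -/
def LineParallel {P L : Type*} [Membership P L] (l m : L) : Prop :=
  l = m ∨ ∀ x : P, ¬ (x ∈ l ∧ x ∈ m)

/-- An affine plane with points `P` and lines `L`; incidence is `∈`. -/
class AffineIncidencePlane (P L : Type*) [Membership P L] : Prop where
  /-- Two distinct points lie on exactly one line. -/
  existsUnique_line : ∀ A B : P, A ≠ B → ∃! l : L, A ∈ l ∧ B ∈ l
  /-- Playfair's axiom. -/
  existsUnique_parallel : ∀ (A : P) (l : L), A ∉ l →
    ∃! m : L, A ∈ m ∧ ∀ x : P, ¬ (x ∈ l ∧ x ∈ m)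
  /-- There are three non-collinear points. -/
  exists_noncollinear : ∃ A B C : P, A ≠ B ∧ A ≠ C ∧ B ≠ C ∧
    ∀ l : L, ¬ (A ∈ l ∧ B ∈ l ∧ C ∈ l)

namespace AffineIncidencePlane

theorem parallel_symm {P L : Type*} [Membership P L] {l m : L} (h : LineParallel l m) :
    LineParallel m l := by
  rcases h with h | h
  · exact Or.inl h.symm
  · exact Or.inr fun x hx => h x ⟨hx.2, hx.1⟩

theorem eq_of_parallel {P L : Type*} [Membership P L] {l m : L} {x : P}
    (h : LineParallel l m) (hl : x ∈ l) (hm : x ∈ m) : l = m := by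
  rcases h with h | h
  · exact h
  · exact absurd ⟨hl, hm⟩ (h x)

theorem exists_mem_of_not_parallel {P L : Type*} [Membership P L] {l m : L}
    (h : ¬ LineParallel l m) : ∃ x : P, x ∈ l ∧ x ∈ m := by
  by_contra hc
  exact h (Or.inr fun x hx => hc ⟨x, hx⟩)

theorem line_unique {P L : Type*} [Membership P L] [AffineIncidencePlane P L] {A B : P}
    {l m : L} (h : A ≠ B) (hAl : A ∈ l) (hBl : B ∈ l) (hAm : A ∈ m) (hBm : B ∈ m) : l = m :=
  (existsUnique_line (L := L) A B h).unique ⟨hAl, hBl⟩ ⟨hAm, hBm⟩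

theorem parallel_unique {P L : Type*} [Membership P L] [AffineIncidencePlane P L] {A : P}
    {l m n : L} (hm : A ∈ m) (hn : A ∈ n) (hml : LineParallel m l) (hnl : LineParallel n l) :
    m = n := by
  by_cases hA : A ∈ l
  · rw [eq_of_parallel hml hm hA, eq_of_parallel hnl hn hA]
  · have key : ∀ k : L, A ∈ k → LineParallel k l → ∀ x : P, ¬ (x ∈ l ∧ x ∈ k) := by
      rintro k hk (rfl | h) x hx
      · exact hA hk
      · exact h x ⟨hx.2, hx.1⟩
    exact (existsUnique_parallel A l hA).unique ⟨hm, key m hm hml⟩ ⟨hn, key n hn hnl⟩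

theorem parallel_trans {P L : Type*} [Membership P L] [AffineIncidencePlane P L] {l m n : L}
    (h₁ : LineParallel l m) (h₂ : LineParallel m n) : LineParallel l n := by
  by_contra h
  obtain ⟨x, hl, hn⟩ := exists_mem_of_not_parallel h
  exact h (Or.inl (parallel_unique hl hn h₁ (parallel_symm h₂)))

theorem exists_line {P : Type*} (L : Type*) [Membership P L] [AffineIncidencePlane P L]
    (A B : P) : ∃ l : L, A ∈ l ∧ B ∈ l := by
  by_cases h : A = B
  · subst h
    obtain ⟨X, Y, -, hXY, -⟩ := exists_noncollinear (P := P) (L := L)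
    have : ∃ Z : P, A ≠ Z := by
      by_cases hX : A = X
      · exact ⟨Y, hX ▸ hXY⟩
      · exact ⟨X, hX⟩
    obtain ⟨Z, hZ⟩ := this
    obtain ⟨l, hl, -⟩ := existsUnique_line (L := L) A Z hZ
    exact ⟨l, hl.1, hl.1⟩
  · exact (existsUnique_line A B h).exists

theorem exists_parallel {P L : Type*} [Membership P L] [AffineIncidencePlane P L]
    (l : L) (A : P) : ∃ m : L, A ∈ m ∧ LineParallel m l := by
  by_cases h : A ∈ l
  · exact ⟨l, h, Or.inl rfl⟩
  · obtain ⟨m, hm, -⟩ := existsUnique_parallel A l h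
    exact ⟨m, hm.1, Or.inr fun x hx => hm.2 x ⟨hx.2, hx.1⟩⟩

theorem exists_not_mem {P L : Type*} [Membership P L] [AffineIncidencePlane P L]
    (l : L) : ∃ A : P, A ∉ l := by
  obtain ⟨A, B, C, -, -, -, h⟩ := exists_noncollinear (P := P) (L := L)
  by_contra hc
  push Not at hc
  exact h l ⟨hc A, hc B, hc C⟩

/-- The line through `A` and `B` (the only one if `A ≠ B`, some line through `A` otherwise). -/
noncomputable def join {P : Type*} (L : Type*) [Membership P L] [AffineIncidencePlane P L]
    (A B : P) : L :=
  Classical.choose (exists_line L A B)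

/-- The line through `A` parallel to `l`. -/
noncomputable def parallelThrough {P L : Type*} [Membership P L] [AffineIncidencePlane P L]
    (l : L) (A : P) : L :=
  Classical.choose (exists_parallel l A)

theorem left_mem_join {P : Type*} (L : Type*) [Membership P L] [AffineIncidencePlane P L]
    (A B : P) : A ∈ join L A B :=
  (Classical.choose_spec (exists_line L A B)).1

theorem right_mem_join {P : Type*} (L : Type*) [Membership P L] [AffineIncidencePlane P L]
    (A B : P) : B ∈ join L A B :=
  (Classical.choose_spec (exists_line L A B)).2

theorem mem_parallelThrough {P L : Type*} [Membership P L] [AffineIncidencePlane P L]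
    (l : L) (A : P) : A ∈ parallelThrough l A :=
  (Classical.choose_spec (exists_parallel l A)).1

theorem parallelThrough_parallel {P L : Type*} [Membership P L] [AffineIncidencePlane P L]
    (l : L) (A : P) : LineParallel (parallelThrough l A) l :=
  (Classical.choose_spec (exists_parallel l A)).2

end AffineIncidencePlane

open AffineIncidencePlane

/-- A Desargues affine plane: an affine plane with Desargues' axiom. Let `a`, `b`, `c` be pairwise
distinct lines that are parallel (first form) or concurrent in a point `S` (second form), and let
`A ≠ A'` lie on `a`, `B ≠ B'` on `b`, `C ≠ C'` on `c`, all of them different from `S`. If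
`AB ∥ A'B'` and `BC ∥ B'C'`, then `AC ∥ A'C'`. -/
class DesarguesAffinePlane (P L : Type*) [Membership P L] : Prop
    extends AffineIncidencePlane P L where
  desargues_parallel : ∀ (a b c : L) (A A' B B' C C' : P),
    a ≠ b → b ≠ c → a ≠ c → LineParallel a b → LineParallel b c →
    A ∈ a → A' ∈ a → B ∈ b → B' ∈ b → C ∈ c → C' ∈ c →
    A ≠ A' → B ≠ B' → C ≠ C' →
    LineParallel (join L A B) (join L A' B') → LineParallel (join L B C) (join L B' C') →
    LineParallel (join L A C) (join L A' C')
  desargues_concurrent : ∀ (a b c : L) (S A A' B B' C C' : P),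
    a ≠ b → b ≠ c → a ≠ c → S ∈ a → S ∈ b → S ∈ c →
    A ∈ a → A' ∈ a → B ∈ b → B' ∈ b → C ∈ c → C' ∈ c →
    A ≠ S → A' ≠ S → B ≠ S → B' ≠ S → C ≠ S → C' ≠ S →
    A ≠ A' → B ≠ B' → C ≠ C' →
    LineParallel (join L A B) (join L A' B') → LineParallel (join L B C) (join L B' C') →
    LineParallel (join L A C) (join L A' C')

namespace AffineIncidencePlane

/-- Addition of points: for an auxiliary point `B₁` off the line `OI`, the parallel to `OI` through
`B₁` and the parallel to `OB₁` through `A` meet in `P₁`; the parallel to `BB₁` through `P₁` meets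
the line `OI` in `C`. -/
def IsSum {P : Type*} (L : Type*) [Membership P L] [AffineIncidencePlane P L]
    (O I A B C : P) : Prop :=
  ∃ B₁ P₁ : P, B₁ ∉ join L O I ∧
    P₁ ∈ parallelThrough (join L O I) B₁ ∧ P₁ ∈ parallelThrough (join L O B₁) A ∧
    C ∈ parallelThrough (join L B B₁) P₁ ∧ C ∈ join L O I

/-- Multiplication of points: for an auxiliary point `B₁` off the line `OI`, the parallel to `IB₁`
through `A` meets the line `OB₁` in `P₁`; the parallel to `BB₁` through `P₁` meets the line `OI`
in `C`. -/
def IsProd {P : Type*} (L : Type*) [Membership P L] [AffineIncidencePlane P L]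
    (O I A B C : P) : Prop :=
  ∃ B₁ P₁ : P, B₁ ∉ join L O I ∧
    P₁ ∈ parallelThrough (join L I B₁) A ∧ P₁ ∈ join L O B₁ ∧
    C ∈ parallelThrough (join L B B₁) P₁ ∧ C ∈ join L O I

theorem exists_meet_parallelThrough {P L : Type*} [Membership P L] [AffineIncidencePlane P L]
    {l m : L} {X Y : P} (Z : P) (hXl : X ∈ l) (hXm : X ∈ m) (hYm : Y ∈ m) (hYl : Y ∉ l) :
    ∃ W : P, W ∈ parallelThrough m Z ∧ W ∈ l := by
  apply exists_mem_of_not_parallel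
  intro h
  have h' := parallel_trans (parallel_symm (parallelThrough_parallel m Z)) h
  exact hYl (eq_of_parallel h' hXm hXl ▸ hYm)

/-- The first step of the addition. -/
theorem exists_sum_aux {P L : Type*} [Membership P L] [AffineIncidencePlane P L] {O I B₁ : P}
    (hB₁ : B₁ ∉ join L O I) (A : P) :
    ∃ P₁ : P, P₁ ∈ parallelThrough (join L O I) B₁ ∧ P₁ ∈ parallelThrough (join L O B₁) A := by
  apply exists_mem_of_not_parallel
  intro h
  have h₁ := parallel_trans (parallel_symm (parallelThrough_parallel (join L O I) B₁)) h
  have h₂ := parallel_trans h₁ (parallelThrough_parallel (join L O B₁) A)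
  exact hB₁ (eq_of_parallel h₂ (left_mem_join L O I) (left_mem_join L O B₁) ▸
    right_mem_join L O B₁)

/-- The first step of the multiplication. -/
theorem exists_prod_aux {P L : Type*} [Membership P L] [AffineIncidencePlane P L] {O I B₁ : P}
    (h : O ≠ I) (hB₁ : B₁ ∉ join L O I) (A : P) :
    ∃ P₁ : P, P₁ ∈ parallelThrough (join L I B₁) A ∧ P₁ ∈ join L O B₁ := by
  refine exists_meet_parallelThrough (X := B₁) (Y := I) A (right_mem_join L O B₁)
    (right_mem_join L I B₁) (left_mem_join L I B₁) fun hI => hB₁ ?_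
  rw [line_unique h (left_mem_join L O I) (right_mem_join L O I) (left_mem_join L O B₁) hI]
  exact right_mem_join L O B₁

/-- The last step of the two constructions read backwards: there is `X` on `l` such that the
parallel to `XB₁` through `P₁` passes through `Q`. -/
theorem exists_last {P L : Type*} [Membership P L] [AffineIncidencePlane P L] {l : L}
    {B₁ P₁ Q : P} (hB₁ : B₁ ∉ l) (hP₁ : P₁ ∉ l) (hQ : Q ∈ l) :
    ∃ X : P, X ∈ l ∧ Q ∈ parallelThrough (join L X B₁) P₁ := by
  obtain ⟨X, hX, hXl⟩ := exists_meet_parallelThrough (m := join L Q P₁) B₁ hQ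
    (left_mem_join L Q P₁) (right_mem_join L Q P₁) hP₁
  have hne : X ≠ B₁ := fun e => hB₁ (e ▸ hXl)
  have e₁ : join L X B₁ = parallelThrough (join L Q P₁) B₁ :=
    line_unique hne (left_mem_join L X B₁) (right_mem_join L X B₁) hX
      (mem_parallelThrough (join L Q P₁) B₁)
  refine ⟨X, hXl, ?_⟩
  rw [e₁, parallel_unique (mem_parallelThrough _ P₁) (right_mem_join L Q P₁)
    (parallelThrough_parallel _ P₁) (parallel_symm (parallelThrough_parallel (join L Q P₁) B₁))]
  exact left_mem_join L Q P₁

/-- The set of points of the line `OI` through two distinct points `O` and `I`. -/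
def LinePoint {P : Type*} (L : Type*) [Membership P L] [AffineIncidencePlane P L]
    {O I : P} (_h : O ≠ I) : Type _ :=
  {X : P // X ∈ join L O I}

namespace LinePoint

theorem exists_sum {P L : Type*} [Membership P L] [AffineIncidencePlane P L] {O I : P}
    {h : O ≠ I} (A B : LinePoint L h) : ∃ C : LinePoint L h, IsSum L O I A.1 B.1 C.1 := by
  obtain ⟨B₁, hB₁⟩ := exists_not_mem (P := P) (join L O I)
  obtain ⟨P₁, h₁, h₂⟩ := exists_sum_aux hB₁ A.1
  obtain ⟨C, hC, hC'⟩ := exists_meet_parallelThrough P₁ B.2 (left_mem_join L B.1 B₁)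
    (right_mem_join L B.1 B₁) hB₁
  exact ⟨⟨C, hC'⟩, B₁, P₁, hB₁, h₁, h₂, hC, hC'⟩

theorem exists_prod {P L : Type*} [Membership P L] [AffineIncidencePlane P L] {O I : P}
    {h : O ≠ I} (A B : LinePoint L h) : ∃ C : LinePoint L h, IsProd L O I A.1 B.1 C.1 := by
  obtain ⟨B₁, hB₁⟩ := exists_not_mem (P := P) (join L O I)
  obtain ⟨P₁, h₁, h₂⟩ := exists_prod_aux h hB₁ A.1
  obtain ⟨C, hC, hC'⟩ := exists_meet_parallelThrough P₁ B.2 (left_mem_join L B.1 B₁)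
    (right_mem_join L B.1 B₁) hB₁
  exact ⟨⟨C, hC'⟩, B₁, P₁, hB₁, h₁, h₂, hC, hC'⟩

theorem exists_opposite {P L : Type*} [Membership P L] [AffineIncidencePlane P L] {O I : P}
    {h : O ≠ I} (A : LinePoint L h) : ∃ X : LinePoint L h, IsSum L O I A.1 X.1 O := by
  obtain ⟨B₁, hB₁⟩ := exists_not_mem (P := P) (join L O I)
  obtain ⟨P₁, h₁, h₂⟩ := exists_sum_aux hB₁ A.1
  have hP₁ : P₁ ∉ join L O I := fun hc => hB₁
    (eq_of_parallel (parallelThrough_parallel (join L O I) B₁) h₁ hc ▸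
      mem_parallelThrough (join L O I) B₁)
  obtain ⟨X, hX, hO⟩ := exists_last hB₁ hP₁ (left_mem_join L O I)
  exact ⟨⟨X, hX⟩, B₁, P₁, hB₁, h₁, h₂, hO, left_mem_join L O I⟩

theorem exists_inverse {P L : Type*} [Membership P L] [AffineIncidencePlane P L] {O I : P}
    {h : O ≠ I} (A : LinePoint L h) (hA : A.1 ≠ O) :
    ∃ X : LinePoint L h, IsProd L O I A.1 X.1 I := by
  obtain ⟨B₁, hB₁⟩ := exists_not_mem (P := P) (join L O I)
  obtain ⟨P₁, h₁, h₂⟩ := exists_prod_aux h hB₁ A.1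
  have hP₁O : P₁ ≠ O := by
    rintro rfl
    have e := line_unique hA (mem_parallelThrough (join L I B₁) A.1) h₁ A.2 (left_mem_join L P₁ I)
    have e' := eq_of_parallel (e ▸ parallelThrough_parallel (join L I B₁) A.1)
      (right_mem_join L P₁ I) (left_mem_join L I B₁)
    exact hB₁ (e' ▸ right_mem_join L I B₁)
  have hP₁ : P₁ ∉ join L O I := fun hc => hB₁
    (line_unique hP₁O h₂ (left_mem_join L O B₁) hc (left_mem_join L O I) ▸
      right_mem_join L O B₁)
  obtain ⟨X, hX, hI⟩ := exists_last hB₁ hP₁ (right_mem_join L O I)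
  exact ⟨⟨X, hX⟩, B₁, P₁, hB₁, h₁, h₂, hI, right_mem_join L O I⟩

/-- The point `O`. -/
instance {P L : Type*} [Membership P L] [AffineIncidencePlane P L] {O I : P} {h : O ≠ I} :
    Zero (LinePoint L h) :=
  ⟨⟨O, left_mem_join L O I⟩⟩

/-- The point `I`. -/
instance {P L : Type*} [Membership P L] [AffineIncidencePlane P L] {O I : P} {h : O ≠ I} :
    One (LinePoint L h) :=
  ⟨⟨I, right_mem_join L O I⟩⟩

/-- The sum `A + B`, constructed with some auxiliary point. -/
noncomputable instance {P L : Type*} [Membership P L] [AffineIncidencePlane P L] {O I : P}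
    {h : O ≠ I} : Add (LinePoint L h) :=
  ⟨fun A B => Classical.choose (exists_sum A B)⟩

/-- The product `A * B`, constructed with some auxiliary point. -/
noncomputable instance {P L : Type*} [Membership P L] [AffineIncidencePlane P L] {O I : P}
    {h : O ≠ I} : Mul (LinePoint L h) :=
  ⟨fun A B => Classical.choose (exists_prod A B)⟩

/-- The opposite point `-A`: the sum of `A` and `-A` is `O`. -/
noncomputable instance {P L : Type*} [Membership P L] [AffineIncidencePlane P L] {O I : P}
    {h : O ≠ I} : Neg (LinePoint L h) :=
  ⟨fun A => Classical.choose (exists_opposite A)⟩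

/-- `A - B = A + (-B)`. -/
noncomputable instance {P L : Type*} [Membership P L] [AffineIncidencePlane P L] {O I : P}
    {h : O ≠ I} : Sub (LinePoint L h) :=
  ⟨fun A B => A + -B⟩

open Classical in
/-- The inverse point of `A ≠ O`: the product of `A` and `A⁻¹` is `I`. (For `A = O` the value is
`O` by convention.) -/
noncomputable instance {P L : Type*} [Membership P L] [AffineIncidencePlane P L] {O I : P}
    {h : O ≠ I} : Inv (LinePoint L h) :=
  ⟨fun A => if hA : A.1 ≠ O then Classical.choose (exists_inverse A hA) else 0⟩

/-- The ratio `r(A, B; C) = (B - C)⁻¹ (A - C)` of three points of the line `OI`. -/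
noncomputable def ratio {P L : Type*} [Membership P L] [AffineIncidencePlane P L] {O I : P}
    {h : O ≠ I} (A B C : LinePoint L h) : LinePoint L h :=
  (B - C)⁻¹ * (A - C)

/-- The ratio map `r_BC : X ↦ r(X, B; C)`. -/
noncomputable def ratioMap {P L : Type*} [Membership P L] [AffineIncidencePlane P L] {O I : P}
    {h : O ≠ I} (B C : LinePoint L h) : LinePoint L h → LinePoint L h :=
  fun X => ratio X B C

end LinePoint

end AffineIncidencePlane

/-! The formulas are ordinary algebra once the line is known to be an additive group in which
multiplication is associative and left distributive, every nonzero point has a two-sided inverse,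
and `-A * B = -(A * B)`. The work is to derive these laws from Desargues' axiom.

The constructions are read as actions of maps of the whole plane. `A + B` is the image of `B` under
the translation sending `O` to `A` (`IsSum.eq_of_isTranslation`). For `A ≠ O`, `A * B` is the image
of `B` under the dilatation fixing `O` and sending `I` to `A` (`IsProd.eq_of_par`). Both
descriptions hold for every auxiliary point, so the choices hidden in the operations are harmless.
The associative laws become composition of maps, commutativity of `+` is commutativity of
translations, and left distributivity says that conjugating a translation by a dilatation fixing `O`
gives a translation (`IsDilatation.map_translation`).

Desargues' axiom supplies the maps: `exists_translation` uses its parallel form and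
`exists_dilatation` its concurrent form, both through `Pencil.exists_map`. Right distributivity is
never needed: the sign of a left factor is moved out by means of the reflection in `O`. -/

namespace AffineIncidencePlane

/-! ### Dilatations and translations of an affine plane -/

section Dilatations

variable {P L : Type*} [Membership P L]

/-- The points `A`, `B` lie on a line parallel to some line through `C`, `D`. -/
def Par (L : Type*) [Membership P L] (A B C D : P) : Prop :=
  ∃ l m : L, A ∈ l ∧ B ∈ l ∧ C ∈ m ∧ D ∈ m ∧ LineParallel l m

theorem Par.of_mem {A B C D : P} {l : L} (hA : A ∈ l) (hB : B ∈ l) (hC : C ∈ l) (hD : D ∈ l) :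
    Par L A B C D :=
  ⟨l, l, hA, hB, hC, hD, Or.inl rfl⟩

theorem Par.symm {A B C D : P} (h : Par L A B C D) : Par L C D A B := by
  obtain ⟨l, m, hA, hB, hC, hD, h⟩ := h
  exact ⟨m, l, hC, hD, hA, hB, parallel_symm h⟩

theorem Par.flip_right {A B C D : P} (h : Par L A B C D) : Par L A B D C := by
  obtain ⟨l, m, hA, hB, hC, hD, h⟩ := h
  exact ⟨l, m, hA, hB, hD, hC, h⟩

theorem Par.flip_left {A B C D : P} (h : Par L A B C D) : Par L B A C D := by
  obtain ⟨l, m, hA, hB, hC, hD, h⟩ := h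
  exact ⟨l, m, hB, hA, hC, hD, h⟩

theorem Par.flip {A B C D : P} (h : Par L A B C D) : Par L B A D C :=
  h.flip_left.flip_right

theorem Par.collinear {A B C : P} (h : Par L A C B C) : ∃ l : L, A ∈ l ∧ B ∈ l ∧ C ∈ l := by
  obtain ⟨l, m, hA, hC, hB, hC', h⟩ := h
  obtain rfl := eq_of_parallel h hC hC'
  exact ⟨l, hA, hB, hC⟩

variable [AffineIncidencePlane P L]

theorem Par.rfl' (A B : P) : Par L A B A B :=
  .of_mem (left_mem_join L A B) (right_mem_join L A B) (left_mem_join L A B) (right_mem_join L A B)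

theorem Par.left_self (A C D : P) : Par L A A C D :=
  ⟨_, join L C D, mem_parallelThrough _ A, mem_parallelThrough _ A, left_mem_join L C D,
    right_mem_join L C D, parallelThrough_parallel _ _⟩

theorem Par.right_self (A B C : P) : Par L A B C C :=
  (Par.left_self C A B).symm

/-- If `AB ∥ CD`, then `D` lies on each line through `C` parallel to `AB`. -/
theorem Par.mem {A B C D : P} {l m : L} (h : Par L A B C D) (hAB : A ≠ B) (hA : A ∈ l)
    (hB : B ∈ l) (hC : C ∈ m) (hlm : LineParallel l m) : D ∈ m := by
  obtain ⟨l', m', hA', hB', hC', hD', h⟩ := h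
  obtain rfl := line_unique hAB hA hB hA' hB'
  rwa [parallel_unique hC hC' (parallel_symm hlm) (parallel_symm h)]

theorem Par.trans {A B C D E F : P} (h₁ : Par L A B C D) (hCD : C ≠ D) (h₂ : Par L C D E F) :
    Par L A B E F := by
  obtain ⟨l, m, hA, hB, hC, hD, h⟩ := h₁
  obtain ⟨l', m', hA', hB', hC', hD', h'⟩ := h₂
  obtain rfl := line_unique hCD hC hD hA' hB'
  exact ⟨l, m', hA, hB, hC', hD', parallel_trans h h'⟩

theorem Par.join {A B C D : P} (h : Par L A B C D) (hAB : A ≠ B) (hCD : C ≠ D) :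
    LineParallel (join L A B) (join L C D) := by
  obtain ⟨l, m, hA, hB, hC, hD, h⟩ := h
  rwa [line_unique hAB (left_mem_join L A B) (right_mem_join L A B) hA hB,
    line_unique hCD (left_mem_join L C D) (right_mem_join L C D) hC hD]

theorem Par.of_join {A B C D : P} (h : LineParallel (AffineIncidencePlane.join L A B)
    (AffineIncidencePlane.join L C D)) : Par L A B C D :=
  ⟨_, _, left_mem_join L A B, right_mem_join L A B, left_mem_join L C D, right_mem_join L C D, h⟩

/-- A point is determined by the directions in which it is seen from two points. -/
theorem eq_of_par {A B C D X Z Y Y' : P} (h : ¬ Par L A B C D) (h₁ : Par L A B X Y)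
    (h₁' : Par L A B X Y') (h₂ : Par L C D Z Y) (h₂' : Par L C D Z Y') : Y = Y' := by
  have hAB : A ≠ B := by rintro rfl; exact h (.left_self _ _ _)
  have hCD : C ≠ D := by rintro rfl; exact h (.right_self _ _ _)
  obtain ⟨l, m, hA, hB, hX, hY, hlm⟩ := h₁
  obtain ⟨k, n, hC, hD, hZ, hY₂, hkn⟩ := h₂
  have hm := h₁'.mem hAB hA hB hX hlm
  have hn := h₂'.mem hCD hC hD hZ hkn
  by_contra hne
  obtain rfl := line_unique hne hY hm hY₂ hn
  exact h ⟨l, k, hA, hB, hC, hD, parallel_trans hlm (parallel_symm hkn)⟩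

theorem exists_noncollinear_of_ne {A B : P} (hAB : A ≠ B) :
    ∃ C : P, ∀ l : L, A ∈ l → B ∈ l → C ∉ l := by
  obtain ⟨C, hC⟩ := exists_not_mem (P := P) (join L A B)
  refine ⟨C, fun l hA hB hCl => hC ?_⟩
  rwa [line_unique hAB (left_mem_join L A B) (right_mem_join L A B) hA hB]

/-- A dilatation: an injective map that sends each line into a parallel line. -/
structure IsDilatation (L : Type*) [Membership P L] (f : P → P) : Prop where
  injective : Function.Injective f
  par : ∀ X Y : P, Par L X Y (f X) (f Y)

theorem IsDilatation.id : IsDilatation L (id : P → P) :=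
  ⟨Function.injective_id, fun X Y => .rfl' X Y⟩

theorem IsDilatation.comp {f g : P → P} (hf : IsDilatation L f) (hg : IsDilatation L g) :
    IsDilatation L (f ∘ g) := by
  refine ⟨hf.injective.comp hg.injective, fun X Y => ?_⟩
  by_cases h : X = Y
  · subst h; exact .left_self _ _ _
  · exact (hg.par X Y).trans (hg.injective.ne h) (hf.par _ _)

theorem IsDilatation.eq_of_noncollinear {f g : P → P} (hf : IsDilatation L f)
    (hg : IsDilatation L g) {A B X : P} (hX : ∀ l : L, A ∈ l → B ∈ l → X ∉ l)
    (hA : f A = g A) (hB : f B = g B) : f X = g X := by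
  refine eq_of_par (L := L) (A := A) (B := X) (C := B) (D := X) ?_ (hf.par A X)
    (hA ▸ hg.par A X) (hf.par B X) (hB ▸ hg.par B X)
  intro h
  obtain ⟨l, h₁, h₂, h₃⟩ := h.collinear
  exact hX l h₁ h₂ h₃

/-- A dilatation is determined by the images of two points. -/
theorem IsDilatation.ext {f g : P → P} (hf : IsDilatation L f) (hg : IsDilatation L g) {A B : P}
    (hAB : A ≠ B) (hA : f A = g A) (hB : f B = g B) : f = g := by
  funext X
  by_cases hXA : X = A
  · rw [hXA, hA]
  by_cases hX : X ∈ join L A B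
  · obtain ⟨C, hC⟩ := exists_noncollinear_of_ne (L := L) hAB
    refine hf.eq_of_noncollinear hg (A := A) (B := C) (fun l hAl hCl hXl => ?_) hA
      (hf.eq_of_noncollinear hg hC hA hB)
    refine hC l hAl ?_ hCl
    rw [line_unique hXA hXl hAl hX (left_mem_join L A B)]
    exact right_mem_join L A B
  · refine hf.eq_of_noncollinear hg (fun l hAl hBl hXl => hX ?_) hA hB
    rwa [line_unique hAB (left_mem_join L A B) (right_mem_join L A B) hAl hBl]

/-- A translation: a dilatation whose traces are all parallel. -/
structure IsTranslation (L : Type*) [Membership P L] (f : P → P) : Prop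
    extends IsDilatation L f where
  trace : ∀ X Y : P, Par L X (f X) Y (f Y)

theorem IsTranslation.id : IsTranslation L (id : P → P) :=
  ⟨.id, fun X _ => .symm (.right_self _ _ X)⟩

/-- A translation with a fixed point is the identity. -/
theorem IsTranslation.eq_id {f : P → P} (hf : IsTranslation L f) {X : P} (hX : f X = X) :
    f = _root_.id := by
  by_contra hne
  obtain ⟨Z, hZ⟩ := exists_not_mem (P := P) (join L X X)
  have hZX : Z ≠ X := by rintro rfl; exact hZ (left_mem_join L Z Z)
  obtain ⟨W, hW⟩ := exists_noncollinear_of_ne (L := L) hZX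
  have hWX : W ≠ X := by
    rintro rfl; exact hW _ (left_mem_join L Z W) (right_mem_join L Z W) (right_mem_join L Z W)
  have hZ' : f Z ≠ Z := fun h => hne (hf.toIsDilatation.ext .id hZX h hX)
  refine hW (join L Z X) (left_mem_join L Z X) (right_mem_join L Z X) ?_
  have hpZ : Par L X Z X (f Z) := by have := hf.par X Z; rwa [hX] at this
  have hfZ : f Z ∈ join L Z X := hpZ.mem hZX.symm
    (right_mem_join L Z X) (left_mem_join L Z X) (right_mem_join L Z X) (Or.inl rfl)
  have hpW : Par L X W X (f W) := by have := hf.par X W; rwa [hX] at this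
  have hfW : f W ∈ join L W X := hpW.mem hWX.symm
    (right_mem_join L W X) (left_mem_join L W X) (right_mem_join L W X) (Or.inl rfl)
  have hW' : f W ≠ W := fun h => hne (hf.toIsDilatation.ext .id hWX h hX)
  -- The traces of `Z` and `W` are parallel and both pass through the fixed point `X`, so they
  -- coincide and `W` lies on `ZX`.
  obtain ⟨l, m, h₁, h₂, h₃, h₄, h⟩ := hf.trace Z W
  have e₁ := line_unique hZ' h₂ h₁ hfZ (left_mem_join L Z X)
  have e₂ := line_unique hW' h₄ h₃ hfW (left_mem_join L W X)
  have e := eq_of_parallel (x := X) h (e₁ ▸ right_mem_join L Z X) (e₂ ▸ right_mem_join L W X)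
  rwa [← e₁, e]

/-- A translation is determined by the image of one point. -/
theorem IsTranslation.ext {f g : P → P} (hf : IsTranslation L f) (hg : IsTranslation L g) {X : P}
    (hX : f X = g X) : f = g := by
  by_cases h : f X = X
  · rw [hf.eq_id h, hg.eq_id (hX ▸ h)]
  obtain ⟨Z, hZ⟩ := exists_noncollinear_of_ne (L := L) (Ne.symm h)
  have hZX : Z ≠ X := by
    rintro rfl
    exact hZ _ (left_mem_join L Z (f Z)) (right_mem_join L Z (f Z)) (left_mem_join L Z (f Z))
  refine hf.toIsDilatation.ext hg.toIsDilatation hZX ?_ hX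
  refine eq_of_par (L := L) (A := f X) (B := X) (C := Z) (D := X) (X := Z) (Z := f X) ?_
    (hf.trace X Z).flip_left ?_ (hf.par X Z).flip_left ?_
  · intro h'
    obtain ⟨l, h₁, h₂, h₃⟩ := h'.collinear
    exact hZ l h₃ h₁ h₂
  · rw [hX]; exact (hg.trace X Z).flip_left
  · rw [hX]; exact (hg.par X Z).flip_left

/-- A dilatation without fixed points is a translation. -/
theorem IsDilatation.isTranslation {f : P → P} (hf : IsDilatation L f) (h : ∀ X, f X ≠ X) :
    IsTranslation L f := by
  refine ⟨hf, fun X Y => .of_join ?_⟩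
  by_contra hn
  obtain ⟨W, hWX, hWY⟩ := exists_mem_of_not_parallel hn
  -- A trace is mapped into itself. If two traces meet in `W`, then `f W` lies on both, and as `W`
  -- is not fixed the traces are equal.
  have key : ∀ X, W ∈ join L X (f X) → f W ∈ join L X (f X) := by
    intro X hW
    by_cases e : X = W
    · subst e; exact right_mem_join L X (f X)
    · exact (hf.par X W).mem e (left_mem_join L X (f X)) hW (right_mem_join L X (f X)) (Or.inl rfl)
  exact hn (Or.inl (line_unique (h W) (key X hWX) hWX (key Y hWY) hWY))

/-- Without fixed points the composite is a translation. If `X` is fixed, `f` carries `g X` back to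
`X`, so both maps have the same trace direction; for `Z` off the trace of `X`, the image of `Z` then
lies on the trace through `Z` and on `ZX`, hence is `Z`, and the composite is the identity. -/
theorem IsTranslation.comp {f g : P → P} (hf : IsTranslation L f) (hg : IsTranslation L g) :
    IsTranslation L (f ∘ g) := by
  have hd := hf.toIsDilatation.comp hg.toIsDilatation
  by_cases h : ∀ X, (f ∘ g) X ≠ X
  · exact hd.isTranslation h
  push Not at h
  obtain ⟨X, hX⟩ := h
  by_cases hgX : g X = X
  · rw [hg.eq_id hgX]; exact hf
  obtain ⟨Z, hZ⟩ := exists_noncollinear_of_ne (L := L) hgX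
  have hZX : Z ≠ X := by
    rintro rfl
    exact hZ _ (left_mem_join L (g Z) Z) (right_mem_join L (g Z) Z) (right_mem_join L (g Z) Z)
  suffices e : f ∘ g = _root_.id by rw [e]; exact .id
  refine hd.ext .id hZX ?_ hX
  have hp : Par L (g X) X (g Z) (f (g Z)) := by
    have := hf.trace (g X) (g Z)
    rwa [show f (g X) = X from hX] at this
  refine eq_of_par (L := L) (A := g X) (B := X) (C := Z) (D := X) (X := Z) (Z := X) ?_
    ?_ (.right_self _ _ _) ?_ (.flip_right (.rfl' _ _))
  · intro h'
    obtain ⟨l, h₁, h₂, h₃⟩ := h'.collinear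
    exact hZ l h₁ h₃ h₂
  · obtain ⟨l, m, h₁, h₂, h₃, h₄, h⟩ := (hg.trace X Z).flip_left
    exact ⟨l, m, h₁, h₂, h₃, hp.mem hgX h₁ h₂ h₄ h, h⟩
  · have := hd.par Z X
    rw [hX] at this
    exact this.flip_right

/-- Both composites send `X` to the fourth vertex of the parallelogram on `X`, `f X`, `g X`. -/
theorem IsTranslation.comm_of_not_par {f g : P → P} (hf : IsTranslation L f)
    (hg : IsTranslation L g) {X : P} (h : ¬ Par L X (f X) X (g X)) : f ∘ g = g ∘ f :=
  (hf.comp hg).ext (hg.comp hf) (X := X) <|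
    eq_of_par h (hf.trace X (g X)) (hg.par X (f X)) (hf.par X (g X)) (hg.trace X (f X))

/-- If `f` and `g` have the same direction, take `h` with another direction. Then `f` commutes with
`h` and with `g ∘ h`, hence with `g` at the point `h X`, which is enough for translations. -/
theorem IsTranslation.comm_of_exists {f g : P → P}
    (H : ∀ A B : P, ∃ h, IsTranslation L h ∧ h A = B) (hf : IsTranslation L f)
    (hg : IsTranslation L g) : f ∘ g = g ∘ f := by
  obtain ⟨X, -⟩ := exists_noncollinear (P := P) (L := L)
  by_cases hfX : f X = X
  · rw [hf.eq_id hfX]; rfl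
  by_cases hgX : g X = X
  · rw [hg.eq_id hgX]; rfl
  by_cases hp : Par L X (f X) X (g X)
  swap
  · exact hf.comm_of_not_par hg hp
  obtain ⟨Y, hY⟩ := exists_noncollinear_of_ne (L := L) hfX
  obtain ⟨h, hh, hhX⟩ := H X Y
  have h₁ : f ∘ h = h ∘ f := by
    refine hf.comm_of_not_par hh (X := X) fun h' => ?_
    obtain ⟨l, h₁, h₂, h₃⟩ := h'.flip.collinear
    exact hY l h₁ h₃ (hhX ▸ h₂)
  have h₂ : f ∘ (g ∘ h) = (g ∘ h) ∘ f := by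
    refine hf.comm_of_not_par (hg.comp hh) (X := X) fun h' => ?_
    obtain ⟨l, h₁, h₂, h₃⟩ := h'.flip.collinear
    have hgl : g X ∈ l := hp.mem (Ne.symm hfX) h₃ h₁ h₃ (Or.inl rfl)
    have := (hg.trace X Y).flip_right.mem (Ne.symm hgX) h₃ hgl (m := l) (hhX ▸ h₂) (Or.inl rfl)
    exact hY l h₁ h₃ this
  refine (hf.comp hg).ext (hg.comp hf) (X := h X) ?_
  calc f (g (h X)) = g (h (f X)) := congrFun h₂ X
    _ = g (f (h X)) := congrArg g (congrFun h₁ X).symm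

end Dilatations

/-! ### Maps built from corresponding segments on a pencil -/

section Pencils

variable {P L : Type*} [Membership P L]

/-- A pencil of lines (a parallel class, or the lines through a point `O`) in which Desargues'
axiom holds: each point of `dom` lies on one line `line X` of the pencil. -/
structure Pencil (P L : Type*) [Membership P L] where
  dom : Set P
  line : P → L
  mem_line : ∀ X ∈ dom, X ∈ line X
  line_eq : ∀ X ∈ dom, ∀ Y ∈ dom, Y ∈ line X → line Y = line X
  -- For the lines through `O` this says that a segment avoiding `O` is never carried to one ending
  -- at `O`.
  mem_dom : ∀ A ∈ dom, ∀ A' ∈ dom, ∀ X ∈ dom, ∀ X' : P, A' ∈ line A → line X ≠ line A →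
    X' ∈ line X → Par L A X A' X' → X' ∈ dom
  desargues : ∀ A ∈ dom, ∀ A' ∈ dom, ∀ B ∈ dom, ∀ B' ∈ dom, ∀ C ∈ dom, ∀ C' ∈ dom,
    A' ∈ line A → B' ∈ line B → C' ∈ line C →
    line A ≠ line B → line B ≠ line C → line A ≠ line C → A ≠ A' → B ≠ B' → C ≠ C' →
    Par L A B A' B' → Par L B C B' C' → Par L A C A' C'

/-- `AA'` and `XX'` are corresponding segments on two lines of the pencil. -/
structure Pencil.Corr (p : Pencil P L) (A A' X X' : P) : Prop where
  left : A ∈ p.dom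
  left' : A' ∈ p.dom
  right : X ∈ p.dom
  right' : X' ∈ p.dom
  mem_left : A' ∈ p.line A
  mem_right : X' ∈ p.line X
  ne_left : A ≠ A'
  ne_right : X ≠ X'
  line_ne : p.line A ≠ p.line X
  par : Par L A X A' X'

namespace Pencil

variable {p : Pencil P L}

theorem Corr.symm {A A' X X' : P} (h : p.Corr A A' X X') : p.Corr X X' A A' :=
  ⟨h.right, h.right', h.left, h.left', h.mem_right, h.mem_left, h.ne_right, h.ne_left,
    h.line_ne.symm, h.par.flip⟩

/-- This is Desargues' axiom; it applies only if the three lines are distinct. -/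
theorem Corr.trans {A A' X X' Y Y' : P} (h₁ : p.Corr A A' X X') (h₂ : p.Corr X X' Y Y')
    (h : p.line A ≠ p.line Y) : p.Corr A A' Y Y' :=
  ⟨h₁.left, h₁.left', h₂.right, h₂.right', h₁.mem_left, h₂.mem_right, h₁.ne_left, h₂.ne_right, h,
    p.desargues A h₁.left A' h₁.left' X h₁.right X' h₁.right' Y h₂.right Y' h₂.right'
      h₁.mem_left h₁.mem_right h₂.mem_right h₁.line_ne h₂.line_ne h h₁.ne_left h₁.ne_right
      h₂.ne_right h₁.par h₂.par⟩

theorem ne_of_line_ne {X Y : P} (h : p.line X ≠ p.line Y) : X ≠ Y := by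
  rintro rfl; exact h rfl

theorem not_mem_of_line_ne {X Y : P} (hX : X ∈ p.dom) (hY : Y ∈ p.dom)
    (h : p.line X ≠ p.line Y) : X ∉ p.line Y :=
  fun hm => h (p.line_eq Y hY X hX hm)

variable [AffineIncidencePlane P L]

theorem Corr.right_unique {A A' X X₁ X₂ : P} (h₁ : p.Corr A A' X X₁) (h₂ : p.Corr A A' X X₂) :
    X₁ = X₂ := by
  by_contra hne
  have hl : Par L A' X₁ A' X₂ := h₁.par.symm.trans (ne_of_line_ne h₁.line_ne) h₂.par
  have e : p.line A' = p.line A := p.line_eq A h₁.left A' h₁.left' h₁.mem_left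
  obtain ⟨l, hl₁, hl₂, hl₃⟩ := hl.flip.collinear
  obtain rfl := line_unique hne hl₁ hl₂ h₁.mem_right h₂.mem_right
  exact not_mem_of_line_ne h₁.left' h₁.right (e ▸ h₁.line_ne) hl₃

theorem exists_corr {A A' X : P} (hA : A ∈ p.dom) (hA' : A' ∈ p.dom) (hX : X ∈ p.dom)
    (hm : A' ∈ p.line A) (hne : A ≠ A') (hl : p.line A ≠ p.line X) :
    ∃ X', p.Corr A A' X X' := by
  obtain ⟨X', h₁, h₂⟩ := exists_meet_parallelThrough (l := p.line X) (m := join L A X) (X := X)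
    (Y := A) A' (p.mem_line X hX) (right_mem_join L A X) (left_mem_join L A X)
    (not_mem_of_line_ne hA hX hl)
  have hp : Par L A X A' X' := ⟨_, _, left_mem_join L A X, right_mem_join L A X,
    mem_parallelThrough _ _, h₁, parallel_symm (parallelThrough_parallel _ _)⟩
  refine ⟨X', hA, hA', hX, p.mem_dom A hA A' hA' X hX X' hm hl.symm h₂ hp, hm, h₂, hne, ?_, hl, hp⟩
  rintro rfl
  obtain ⟨l, h₁, h₂, h₃⟩ := hp.collinear
  obtain rfl := line_unique hne h₁ h₂ (p.mem_line A hA) hm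
  exact not_mem_of_line_ne hX hA hl.symm h₃

/-- A point off the line of `A` is moved by comparison with `AA'`, a point off the line of `Z` by
comparison with `ZZ'`; `Corr.trans` makes the two agree. Two points on different lines can be
compared through a common reference segment unless one is on the line of `A` and the other on that
of `Z`. That remaining case is the hypothesis `H`. -/
theorem exists_map (p : Pencil P L) {A A' Z Z' : P} (hZ : p.Corr A A' Z Z')
    (H : ∀ X X' Y Y', p.line X = p.line A → p.line Y = p.line Z → p.Corr Z Z' X X' →
      p.Corr A A' Y Y' → p.Corr X X' Y Y') :
    ∃ f : P → P, f A = A' ∧ (∀ X ∈ p.dom, f X ∈ p.dom ∧ f X ∈ p.line X) ∧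
      (∀ X ∈ p.dom, ∀ Y ∈ p.dom, Par L X Y (f X) (f Y)) ∧ Set.InjOn f p.dom := by
  have hf : ∀ X, ∃ X', X ∈ p.dom →
      (p.line A ≠ p.line X → p.Corr A A' X X') ∧ (p.line Z ≠ p.line X → p.Corr Z Z' X X') := by
    intro X
    by_cases hX : X ∈ p.dom
    swap
    · exact ⟨X, fun h => absurd h hX⟩
    by_cases h : p.line A = p.line X
    · obtain ⟨X', hX'⟩ := exists_corr hZ.right hZ.right' hX hZ.mem_right hZ.ne_right
        (h ▸ hZ.line_ne.symm)
      exact ⟨X', fun _ => ⟨fun h' => absurd h h', fun _ => hX'⟩⟩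
    · obtain ⟨X', hX'⟩ := exists_corr hZ.left hZ.left' hX hZ.mem_left hZ.ne_left h
      exact ⟨X', fun _ => ⟨fun _ => hX', fun h' => hZ.symm.trans hX' h'⟩⟩
  choose f hf using hf
  have key : ∀ X ∈ p.dom, ∀ Y ∈ p.dom, p.line X ≠ p.line Y → p.Corr X (f X) Y (f Y) := by
    intro X hX Y hY hXY
    by_cases hXA : p.line A = p.line X
    · have hXZ : p.line Z ≠ p.line X := hXA ▸ hZ.line_ne.symm
      by_cases hYZ : p.line Z = p.line Y
      · exact H _ _ _ _ hXA.symm hYZ.symm ((hf X hX).2 hXZ) ((hf Y hY).1 (hYZ ▸ hZ.line_ne))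
      · exact ((hf X hX).2 hXZ).symm.trans ((hf Y hY).2 hYZ) hXY
    · by_cases hYA : p.line A = p.line Y
      · have hYZ : p.line Z ≠ p.line Y := hYA ▸ hZ.line_ne.symm
        by_cases hXZ : p.line Z = p.line X
        · exact (H _ _ _ _ hYA.symm hXZ.symm ((hf Y hY).2 hYZ)
            ((hf X hX).1 (hXZ ▸ hZ.line_ne))).symm
        · exact ((hf X hX).2 hXZ).symm.trans ((hf Y hY).2 hYZ) hXY
      · exact ((hf X hX).1 hXA).symm.trans ((hf Y hY).1 hYA) hXY
  have other : ∀ X, ∃ Y ∈ p.dom, p.line X ≠ p.line Y := by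
    intro X
    by_cases h : p.line X = p.line A
    · exact ⟨Z, hZ.right, h ▸ hZ.line_ne⟩
    · exact ⟨A, hZ.left, h⟩
  have hmem : ∀ X ∈ p.dom, f X ∈ p.dom ∧ f X ∈ p.line X := by
    intro X hX
    obtain ⟨Y, hY, hXY⟩ := other X
    have := key X hX Y hY hXY
    exact ⟨this.left', this.mem_left⟩
  refine ⟨f, ((hf A hZ.left).2 hZ.line_ne.symm).right_unique hZ.symm, hmem, ?_, ?_⟩
  · intro X hX Y hY
    by_cases h : p.line X = p.line Y
    · exact .of_mem (p.mem_line X hX) (h ▸ p.mem_line Y hY) (hmem X hX).2 (h ▸ (hmem Y hY).2)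
    · exact (key X hX Y hY h).par
  · intro X hX Y hY e
    obtain ⟨W, hW, hXW⟩ := other X
    have h₁ := key X hX W hW hXW
    by_cases h : p.line X = p.line Y
    · have h₂ := key Y hY W hW (h ▸ hXW)
      -- If `X` and `Y` had the same image, `XW` and `YW` would be parallel, and `W` would lie on
      -- the line of `X`.
      by_contra hne
      have hp : Par L Y W (f X) (f W) := e ▸ h₂.par
      have hp' := h₁.par.trans (ne_of_line_ne (p := p) ?_) hp.symm
      · obtain ⟨l, h₃, h₄, h₅⟩ := hp'.collinear
        obtain rfl := line_unique hne h₃ h₄ (p.mem_line X hX) (h ▸ p.mem_line Y hY)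
        exact not_mem_of_line_ne hW hX hXW.symm h₅
      · rw [p.line_eq X hX _ h₁.left' h₁.mem_left, p.line_eq W hW _ h₁.right' h₁.mem_right]
        exact hXW
    · exact absurd ((p.line_eq X hX _ (hmem X hX).1 (hmem X hX).2).symm.trans
        (e ▸ p.line_eq Y hY _ (hmem Y hY).1 (hmem Y hY).2)) h

/-- A third line of the pencil settles the case left open in `exists_map`: `XX'` reaches `WW'`
through `ZZ'`, and `YY'` reaches it through `AA'`. -/
theorem Corr.cross {A A' Z Z' W X X' Y Y' : P} (hZ : p.Corr A A' Z Z') (hW : W ∈ p.dom)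
    (hWA : p.line W ≠ p.line A) (hWZ : p.line W ≠ p.line Z) (hXA : p.line X = p.line A)
    (hYZ : p.line Y = p.line Z) (hX : p.Corr Z Z' X X') (hY : p.Corr A A' Y Y') :
    p.Corr X X' Y Y' := by
  obtain ⟨W', hW'⟩ := exists_corr hZ.left hZ.left' hW hZ.mem_left hZ.ne_left hWA.symm
  have h₁ := hX.symm.trans (hZ.symm.trans hW' hWZ.symm) (hXA ▸ hWA.symm)
  have h₂ := hY.symm.trans hW' (hYZ ▸ hWZ.symm)
  exact h₁.trans h₂.symm (by rw [hXA, hYZ]; exact hZ.line_ne)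

end Pencil

/-- If one of two parallel lines has three points, the two lines do not cover the plane. -/
theorem exists_off_parallel [AffineIncidencePlane P L]
    {l m : L} {A B C X : P} (hlm : LineParallel l m)
    (hA : A ∈ l) (hB : B ∈ l) (hC : C ∈ l) (hAB : A ≠ B) (hAC : A ≠ C) (hBC : B ≠ C) (hX : X ∈ m)
    (hXl : X ∉ l) : ∃ W, W ∉ l ∧ W ∉ m := by
  have hBX : B ∉ join L X C := fun h => hXl
    (line_unique hBC h (right_mem_join L X C) hB hC ▸ left_mem_join L X C)
  -- `W` is the intersection of `XC` with the parallel to `XB` through `A`. On `l` it would be `C`,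
  -- making that parallel `l` itself; on `m` it would be `X`, putting `A` on `XB`.
  obtain ⟨W, hW, hW'⟩ := exists_meet_parallelThrough A (left_mem_join L X C)
    (left_mem_join L X B) (right_mem_join L X B) hBX
  have hp := parallelThrough_parallel (join L X B) A
  have hm := mem_parallelThrough (join L X B) A
  refine ⟨W, fun h => ?_, fun h => ?_⟩
  · have e : W = C := by
      by_contra hne
      exact hXl (line_unique hne hW' (right_mem_join L X C) h hC ▸ left_mem_join L X C)
    subst e
    have e := line_unique hAC hm hW hA hC
    have e' := eq_of_parallel (e ▸ hp) hB (right_mem_join L X B)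
    exact hXl (e' ▸ left_mem_join L X B)
  · have e : W = X := by
      by_contra hne
      have e := line_unique hne hW' (left_mem_join L X C) h hX
      exact hXl (eq_of_parallel hlm hC (e ▸ right_mem_join L X C) ▸ hX)
    subst e
    have e := eq_of_parallel hp hW (left_mem_join L W B)
    have e' := line_unique hAB (e ▸ hm) (right_mem_join L W B) hA hB
    exact hXl (e' ▸ left_mem_join L W B)

/-! ### Existence of translations and central dilatations -/

section Desargues

variable [DesarguesAffinePlane P L]

/-- The lines parallel to `l`. -/
noncomputable def parallelPencil (l : L) : Pencil P L where
  dom := Set.univ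
  line := parallelThrough l
  mem_line X _ := mem_parallelThrough l X
  line_eq X _ Y _ h := parallel_unique (mem_parallelThrough l Y) h (parallelThrough_parallel l Y)
    (parallelThrough_parallel l X)
  mem_dom := by intros; trivial
  desargues A _ A' _ B _ B' _ C _ C' _ hA' hB' hC' hab hbc hac hA hB hC h₁ h₂ := by
    have ne : ∀ {X X' Y Y' : P}, X' ∈ parallelThrough l X → Y' ∈ parallelThrough l Y →
        parallelThrough l X ≠ parallelThrough l Y → X' ≠ Y' := by
      rintro X X' Y _ hX hY hn rfl
      exact hn (parallel_unique hX hY (parallelThrough_parallel l X)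
        (parallelThrough_parallel l Y))
    have par : ∀ X Y : P, LineParallel (parallelThrough l X) (parallelThrough l Y) := fun X Y =>
      parallel_trans (parallelThrough_parallel l X) (parallel_symm (parallelThrough_parallel l Y))
    have mem : ∀ X : P, X ∈ parallelThrough l X := mem_parallelThrough l
    exact .of_join <| DesarguesAffinePlane.desargues_parallel _ _ _ A A' B B' C C' hab hbc hac
      (par A B) (par B C) (mem A) hA' (mem B) hB' (mem C) hC' hA hB hC
      (h₁.join (ne (mem A) (mem B) hab) (ne hA' hB' hab))
      (h₂.join (ne (mem B) (mem C) hbc) (ne hB' hC' hbc))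

/-- The lines through `O`. -/
noncomputable def centralPencil (L : Type*) [Membership P L] [DesarguesAffinePlane P L] (O : P) :
    Pencil P L where
  dom := {X | X ≠ O}
  line := join L O
  mem_line X _ := right_mem_join L O X
  line_eq X _ Y hY h := line_unique hY (right_mem_join L O Y) (left_mem_join L O Y) h
    (left_mem_join L O X)
  mem_dom A hA A' hA' X hX X' hA'l hl hX'l hp := by
    rintro rfl
    have : X ∈ join L X' A := hp.symm.mem hA' hA'l (left_mem_join L X' A) (right_mem_join L X' A)
      (Or.inl rfl)
    exact hl (line_unique hX (right_mem_join L X' X) (left_mem_join L X' X) this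
      (left_mem_join L X' A))
  desargues A hAO A' hAO' B hBO B' hBO' C hCO C' hCO' hA' hB' hC' hab hbc hac hA hB hC h₁ h₂ := by
    have ne : ∀ {X X' Y Y' : P}, X' ≠ O → X' ∈ join L O X → Y' ∈ join L O Y →
        join L O X ≠ join L O Y → X' ≠ Y' := by
      rintro X X' Y _ hO hX hY hn rfl
      exact hn (line_unique hO hX (left_mem_join L O X) hY (left_mem_join L O Y))
    have mem : ∀ X : P, X ∈ join L O X := right_mem_join L O
    have memO : ∀ X : P, O ∈ join L O X := left_mem_join L O
    exact .of_join <| DesarguesAffinePlane.desargues_concurrent _ _ _ O A A' B B' C C' hab hbc hac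
      (memO A) (memO B) (memO C) (mem A) hA' (mem B) hB' (mem C) hC' hAO hAO' hBO hBO' hCO hCO'
      hA hB hC (h₁.join (ne hAO (mem A) (mem B) hab) (ne hAO' hA' hB' hab))
      (h₂.join (ne hBO (mem B) (mem C) hbc) (ne hBO' hB' hC' hbc))

/-- The map comes from the pencil of parallels to `AB`. A third parallel gives `H` by `Corr.cross`;
it can be missing only when the lines of `A` and `Z` have two points each, and then `H` is checked
by cases. -/
theorem exists_translation (L : Type*) [Membership P L] [DesarguesAffinePlane P L] (A B : P) :
    ∃ f, IsTranslation L f ∧ f A = B := by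
  by_cases hAB : A = B
  · exact ⟨id, .id, hAB⟩
  set p := parallelPencil (P := P) (join L A B) with hp
  have dom : ∀ X, X ∈ p.dom := fun X => Set.mem_univ X
  have par : ∀ X Y, LineParallel (p.line X) (p.line Y) := fun X Y =>
    parallel_trans (parallelThrough_parallel _ X) (parallel_symm (parallelThrough_parallel _ Y))
  have hB : B ∈ p.line A := by
    have : p.line A = join L A B :=
      eq_of_parallel (parallelThrough_parallel _ A) (p.mem_line A (dom A)) (left_mem_join L A B)
    rw [this]; exact right_mem_join L A B
  obtain ⟨Z, hZ⟩ := exists_not_mem (P := P) (p.line A)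
  have hl : p.line A ≠ p.line Z := fun e => hZ (e ▸ p.mem_line Z (dom Z))
  obtain ⟨Z', hZ'⟩ := Pencil.exists_corr (dom A) (dom B) (dom Z) hB hAB hl
  suffices H : ∀ X X' Y Y', p.line X = p.line A → p.line Y = p.line Z → p.Corr Z Z' X X' →
      p.Corr A B Y Y' → p.Corr X X' Y Y' by
    obtain ⟨f, hfA, hf, hpar, hinj⟩ := p.exists_map hZ' H
    refine ⟨f, ⟨⟨fun X Y => hinj (dom X) (dom Y), fun X Y => hpar X (dom X) Y (dom Y)⟩,
      fun X Y => ?_⟩, hfA⟩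
    exact ⟨p.line X, p.line Y, p.mem_line X (dom X), (hf X (dom X)).2, p.mem_line Y (dom Y),
      (hf Y (dom Y)).2, par X Y⟩
  intro X X' Y Y' hX hY hX' hY'
  by_cases hW : ∃ W, W ∉ p.line A ∧ W ∉ p.line Z
  · obtain ⟨W, hWA, hWZ⟩ := hW
    exact hZ'.cross (dom W) (fun e => hWA (e ▸ p.mem_line W (dom W)))
      (fun e => hWZ (e ▸ p.mem_line W (dom W))) hX hY hX' hY'
  have key : ∀ {C D U V}, p.line C ≠ p.line V → D ∈ p.line C → U ∈ p.line C → C ≠ D →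
      (¬ ∃ W, W ∉ p.line C ∧ W ∉ p.line V) → U = C ∨ U = D := by
    intro C D U V hCV hD hU hCD hW
    by_contra hc
    push Not at hc
    exact hW (exists_off_parallel (par C V) (p.mem_line C (dom C)) hD hU hCD hc.1.symm hc.2.symm
      (p.mem_line V (dom V)) (Pencil.not_mem_of_line_ne (dom V) (dom C) hCV.symm))
  have hW' : ¬ ∃ W, W ∉ p.line Z ∧ W ∉ p.line A := fun ⟨W, h₁, h₂⟩ => hW ⟨W, h₂, h₁⟩
  have mX : X = A ∨ X = B := key hl hB (hX ▸ p.mem_line X (dom X)) hAB hW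
  have mX' : X' = A ∨ X' = B := key hl hB (hX ▸ hX'.mem_right) hAB hW
  have mY : Y = Z ∨ Y = Z' :=
    key hl.symm hZ'.mem_right (hY ▸ p.mem_line Y (dom Y)) hZ'.ne_right hW'
  have mY' : Y' = Z ∨ Y' = Z' := key hl.symm hZ'.mem_right (hY ▸ hY'.mem_right) hZ'.ne_right hW'
  have nX := hX'.ne_right
  have nY := hY'.ne_right
  have hXY : p.line X ≠ p.line Y := by rw [hX, hY]; exact hl
  refine ⟨dom X, dom X', dom Y, dom Y', hX'.mem_right, hY'.mem_right, nX, nY, hXY, ?_⟩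
  rcases mX with rfl | rfl <;> rcases mX' with rfl | rfl <;> rcases mY with rfl | rfl <;>
    rcases mY' with rfl | rfl
  all_goals first
    | exact absurd rfl nX
    | exact absurd rfl nY
    | exact hZ'.par
    | exact hZ'.par.symm
    | exact hX'.par.flip
    | exact hY'.par

/-- The parallel to `AZ` through `O` is such a line, and `W` is the fourth vertex of the
parallelogram on `O`, `A`, `Z`. Unlike for parallel pencils, there is no exceptional small plane. -/
theorem exists_third_line {O A Z : P} (hA : A ≠ O) (hZ : Z ≠ O) (h : join L O A ≠ join L O Z) :
    ∃ W, W ≠ O ∧ join L O W ≠ join L O A ∧ join L O W ≠ join L O Z := by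
  have hAZ : A ≠ Z := by rintro rfl; exact h rfl
  have hO : O ∉ join L A Z := fun hO => h
    ((line_unique hA (right_mem_join L O A) (left_mem_join L O A) (left_mem_join L A Z) hO).trans
      (line_unique hZ (right_mem_join L O Z) (left_mem_join L O Z) (right_mem_join L A Z) hO).symm)
  have hk := mem_parallelThrough (join L A Z) O
  have hp := parallelThrough_parallel (join L A Z) O
  have hAk : A ∉ parallelThrough (join L A Z) O := fun hA =>
    hO (eq_of_parallel hp hA (left_mem_join L A Z) ▸ hk)
  have hZk : Z ∉ parallelThrough (join L A Z) O := fun hA =>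
    hO (eq_of_parallel hp hA (right_mem_join L A Z) ▸ hk)
  obtain ⟨W, hW, hWk⟩ := exists_meet_parallelThrough Z hk (left_mem_join L O A)
    (right_mem_join L O A) hAk
  have hWO : W ≠ O := by
    rintro rfl
    have e := eq_of_parallel (parallelThrough_parallel (join L W A) Z) hW (left_mem_join L W A)
    exact h (line_unique hZ (right_mem_join L W Z) (left_mem_join L W Z)
      (e ▸ mem_parallelThrough (join L W A) Z) (left_mem_join L W A)).symm
  have e : join L O W = parallelThrough (join L A Z) O :=
    line_unique hWO (right_mem_join L O W) (left_mem_join L O W) hWk hk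
  exact ⟨W, hWO, fun h => hAk (e ▸ h ▸ right_mem_join L O A),
    fun h => hZk (e ▸ h ▸ right_mem_join L O Z)⟩

open Classical in
theorem exists_dilatation {O A B : P} (hA : A ≠ O) (hB : B ≠ O) (h : B ∈ join L O A) :
    ∃ f, IsDilatation L f ∧ f O = O ∧ f A = B := by
  by_cases hAB : A = B
  · exact ⟨id, .id, rfl, hAB⟩
  set p := centralPencil L O with hp
  obtain ⟨Z, hZ⟩ := exists_not_mem (P := P) (join L O A)
  have hZO : Z ≠ O := by rintro rfl; exact hZ (left_mem_join L Z A)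
  have hl : p.line A ≠ p.line Z := fun e =>
    hZ ((show join L O A = join L O Z from e) ▸ right_mem_join L O Z)
  obtain ⟨Z', hZ'⟩ := Pencil.exists_corr (p := p) hA hB hZO h hAB hl
  obtain ⟨f, hfA, hf, hpar, hinj⟩ := p.exists_map hZ' fun X X' Y Y' hX hY hX' hY' => by
    obtain ⟨W, hW, hWA, hWZ⟩ := exists_third_line hA hZO hl
    exact hZ'.cross hW hWA hWZ hX hY hX' hY'
  have hO : ∀ X, X ≠ O → f X ≠ O := fun X hX => (hf X hX).1
  refine ⟨fun X => if X = O then O else f X, ⟨fun X Y e => ?_, fun X Y => ?_⟩, by simp,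
    by simp [hA, hfA]⟩
  · by_cases hX : X = O <;> by_cases hY : Y = O <;> simp only [hX, hY, if_true, if_false] at e ⊢
    · exact absurd e.symm (hO Y hY)
    · exact absurd e (hO X hX)
    · exact hinj hX hY e
  · by_cases hX : X = O <;> by_cases hY : Y = O <;> simp only [hX, hY, if_true, if_false]
    · exact .rfl' O O
    · exact .of_mem (left_mem_join L O Y) (right_mem_join L O Y) (left_mem_join L O Y) (hf Y hY).2
    · exact .of_mem (right_mem_join L O X) (left_mem_join L O X) (hf X hX).2 (left_mem_join L O X)
    · exact hpar X hX Y hY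

end Desargues

end Pencils

/-! ### Sum and product as actions of translations and dilatations -/

section Operations

variable {P L : Type*} [Membership P L]

theorem par_of_mem_parallelThrough [AffineIncidencePlane P L] {A B X Y : P}
    (h : Y ∈ parallelThrough (join L A B) X) : Par L A B X Y :=
  ⟨_, _, left_mem_join L A B, right_mem_join L A B, mem_parallelThrough _ _, h,
    parallel_symm (parallelThrough_parallel _ _)⟩

theorem not_par_of_not_mem_join [AffineIncidencePlane P L] {O I B Q : P} (hOI : O ≠ I)
    (hB : B ∈ join L O I) (hQ : Q ∉ join L O I) : ¬ Par L B Q O I := by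
  rintro ⟨l, m, h₁, h₂, h₃, h₄, h⟩
  obtain rfl := line_unique hOI h₃ h₄ (left_mem_join L O I) (right_mem_join L O I)
  exact hQ (eq_of_parallel h h₁ hB ▸ h₂)

theorem not_par_join [AffineIncidencePlane P L] {O I Q : P} (hOI : O ≠ I)
    (hQ : Q ∉ join L O I) : ¬ Par L O I O Q := by
  intro h
  obtain ⟨l, h₁, h₂, h₃⟩ := h.flip.collinear
  rw [line_unique hOI h₃ h₁ (left_mem_join L O I) (right_mem_join L O I)] at h₂
  exact hQ h₂

/-- `A + B` is the image of `B` under the translation that sends `O` to `A`. -/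
theorem IsSum.eq_of_isTranslation [AffineIncidencePlane P L] {O I A B C : P} {f : P → P}
    (hOI : O ≠ I) (hA : A ∈ join L O I) (hB : B ∈ join L O I) (hf : IsTranslation L f)
    (hfO : f O = A) (h : IsSum L O I A B C) : C = f B := by
  obtain ⟨B₁, P₁, hB₁, h₁, h₂, h₃, hC⟩ := h
  have htr : ∀ X, Par L O I X (f X) := by
    intro X
    by_cases hAO : A = O
    · rw [hf.eq_id (hfO.trans hAO)]; exact .right_self _ _ _
    · have := hf.trace O X
      rw [hfO] at this
      exact .trans (.of_mem (left_mem_join L O I) (right_mem_join L O I) (left_mem_join L O I) hA)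
        (Ne.symm hAO) this
  have e : P₁ = f B₁ := by
    refine eq_of_par (not_par_join hOI hB₁) (par_of_mem_parallelThrough h₁) (htr B₁)
      (par_of_mem_parallelThrough h₂) ?_
    have := hf.par O B₁
    rwa [hfO] at this
  refine eq_of_par (not_par_of_not_mem_join hOI hB hB₁) (par_of_mem_parallelThrough h₃)
    (e ▸ (hf.par B B₁).flip_right)
    (Par.of_mem (left_mem_join L O I) (right_mem_join L O I) hB hC) (htr B)

/-- `A * B` is the image of `B` under the dilatation that fixes `O` and sends `I` to `A`. -/
theorem IsProd.eq_of_par [AffineIncidencePlane P L] {O I A B C : P} {f : P → P} (hOI : O ≠ I)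
    (hB : B ∈ join L O I) (hf : ∀ X Y, Par L X Y (f X) (f Y)) (hfO : f O = O) (hfI : f I = A)
    (h : IsProd L O I A B C) : C = f B := by
  obtain ⟨B₁, P₁, hB₁, h₁, h₂, h₃, hC⟩ := h
  have hl := left_mem_join L O I
  have hr := right_mem_join L O I
  have hO : ∀ X, Par L O X O (f X) := by
    intro X
    have := hf O X
    rwa [hfO] at this
  have e : P₁ = f B₁ := by
    refine AffineIncidencePlane.eq_of_par (A := I) (B := B₁) (C := O) (D := B₁) (Z := O)
      (fun h => ?_) (par_of_mem_parallelThrough h₁) (hfI ▸ hf I B₁)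
      (.of_mem (left_mem_join L O B₁) (right_mem_join L O B₁) (left_mem_join L O B₁) h₂) (hO B₁)
    obtain ⟨l, hI, hO, hl'⟩ := h.collinear
    rw [line_unique hOI hO hI hl hr] at hl'
    exact hB₁ hl'
  have hfB : f B ∈ join L O I := by
    by_cases hBO : B = O
    · rw [hBO, hfO]; exact hl
    · exact (hO B).mem (Ne.symm hBO) hl hB hl (Or.inl rfl)
  refine AffineIncidencePlane.eq_of_par (not_par_of_not_mem_join hOI hB hB₁)
    (par_of_mem_parallelThrough h₃) (e ▸ (hf B B₁).flip_right)
    (Par.of_mem hl hr hB hC) (.of_mem hl hr hB hfB)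

variable [DesarguesAffinePlane P L]

/-- The translation that sends `O` to `A`. -/
noncomputable def translation (L : Type*) [Membership P L] [DesarguesAffinePlane P L]
    (O A : P) : P → P :=
  Classical.choose (exists_translation L O A)

theorem isTranslation_translation (O A : P) : IsTranslation L (translation L O A) :=
  (Classical.choose_spec (exists_translation L O A)).1

theorem translation_apply (O A : P) : translation L O A O = A :=
  (Classical.choose_spec (exists_translation L O A)).2

theorem translation_self (O : P) : translation L O O = id :=
  (isTranslation_translation O O).eq_id (translation_apply O O)

theorem IsTranslation.comm {f g : P → P} (hf : IsTranslation L f) (hg : IsTranslation L g) :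
    f ∘ g = g ∘ f :=
  hf.comm_of_exists (exists_translation L) hg

theorem translation_comp (O A B : P) :
    translation L O A ∘ translation L O B = translation L O (translation L O A B) :=
  ((isTranslation_translation O A).comp (isTranslation_translation O B)).ext
    (isTranslation_translation O _) (X := O) (by
      simp only [Function.comp_apply, translation_apply])

/-- Conjugation of a translation by a dilatation that fixes `O`. -/
theorem IsDilatation.map_translation {f : P → P} (hf : IsDilatation L f) {O : P} (hfO : f O = O)
    (B X : P) : f (translation L O B X) = translation L O (f B) (f X) := by
  by_cases hBO : B = O
  · rw [hBO, hfO, translation_self]; rfl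
  obtain ⟨Z, hZ⟩ := exists_noncollinear_of_ne (L := L) (Ne.symm hBO)
  have hZO : O ≠ Z := by
    rintro rfl
    exact hZ _ (left_mem_join L O B) (right_mem_join L O B) (left_mem_join L O B)
  have hB := isTranslation_translation (L := L) O B
  have hfB := isTranslation_translation (L := L) O (f B)
  have hO : f (translation L O B O) = translation L O (f B) (f O) := by
    rw [translation_apply, hfO, translation_apply]
  refine congrFun (f := f ∘ translation L O B) (g := translation L O (f B) ∘ f) ?_ X
  have d₁ := hf.comp hB.toIsDilatation
  have d₂ := hfB.toIsDilatation.comp hf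
  refine d₁.ext d₂ hZO hO ?_
  have ht := hB.trace O Z
  have ht' := hfB.trace O (f Z)
  have hOB := hf.par O B
  have p₁ := d₁.par O Z
  have p₂ := d₂.par O Z
  simp only [Function.comp_apply, hfO, translation_apply] at ht ht' hOB p₁ p₂ ⊢
  have hne : translation L O B Z ≠ Z := fun h => hBO (by
    rw [← translation_apply (L := L) O B, hB.eq_id h]; rfl)
  -- Both images of `Z` lie on the parallel to `OB` through `f Z` and on the parallel to `OZ`
  -- through `f B`.
  refine eq_of_par (A := O) (B := B) (C := O) (D := Z) (X := f Z) ?_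
    (ht.trans hne.symm (hf.par _ _)) (hOB.trans (fun h => hBO ?_) ht') p₁ p₂
  · intro h
    obtain ⟨l, h₁, h₂, h₃⟩ := h.flip.collinear
    exact hZ l h₃ h₁ h₂
  · exact hf.injective (h.symm.trans hfO.symm)

/-- The reflection in the point `O`. -/
theorem exists_reflection (L : Type*) [Membership P L] [DesarguesAffinePlane P L] (O : P) :
    ∃ f, IsDilatation L f ∧ ∀ X, translation L O X (f X) = O := by
  have ht := fun X => isTranslation_translation (L := L) X O
  have hX : ∀ X, translation L X O ∘ translation L O X = id := fun X =>
    ((ht X).comp (isTranslation_translation O X)).eq_id (X := O) (by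
      simp only [Function.comp_apply, translation_apply])
  have hX' : ∀ X, translation L O X ∘ translation L X O = id := fun X =>
    ((isTranslation_translation O X).comm (ht X)).trans (hX X)
  refine ⟨fun X => translation L X O O, ⟨fun X Y h => ?_, fun X Y => ?_⟩,
    fun X => congrFun (hX' X) O⟩
  · have e := (ht X).ext (ht Y) (X := O) h
    refine (ht X).injective ?_
    rw [translation_apply, e, translation_apply]
  -- This translation sends `Y` to `X` and the reflection of `X` to that of `Y`, so its two traces
  -- are the required parallels.
  · have h := ((isTranslation_translation (L := L) O X).comp (ht Y)).trace Y (translation L X O O)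
    have e : translation L O X (translation L Y O (translation L X O O)) = translation L Y O O := by
      rw [show translation L Y O (translation L X O O) = translation L X O (translation L Y O O)
        from congrFun ((ht Y).comm (ht X)) O]
      exact congrFun (hX' X) _
    simp only [Function.comp_apply, translation_apply, e] at h
    exact h.flip_left

end Operations

/-! ### Algebra of the points of the line `OI` -/

namespace LinePoint

variable {P L : Type*} [Membership P L] [DesarguesAffinePlane P L] {O I : P} {h : O ≠ I}

theorem val_zero : (0 : LinePoint L h).1 = O := rfl

theorem eq_zero_iff {A : LinePoint L h} : A = 0 ↔ A.1 = O := Subtype.ext_iff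

theorem val_add (A B : LinePoint L h) : (A + B).1 = translation L O A.1 B.1 :=
  IsSum.eq_of_isTranslation h A.2 B.2 (isTranslation_translation O A.1) (translation_apply O A.1)
    (Classical.choose_spec (exists_sum A B))

theorem add_neg (A : LinePoint L h) : A + -A = 0 := by
  refine Subtype.ext ((val_add A (-A)).trans ?_)
  exact (IsSum.eq_of_isTranslation h A.2 (-A).2 (isTranslation_translation O A.1)
    (translation_apply O A.1) (Classical.choose_spec (exists_opposite A))).symm

theorem add_assoc (A B C : LinePoint L h) : A + B + C = A + (B + C) := by
  refine Subtype.ext ?_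
  rw [val_add, val_add, val_add, val_add, ← translation_comp]
  rfl

theorem add_comm (A B : LinePoint L h) : A + B = B + A := by
  refine Subtype.ext ?_
  have := congrFun ((isTranslation_translation (L := L) O A.1).comm
    (isTranslation_translation O B.1)) O
  simp only [Function.comp_apply, translation_apply] at this
  rw [val_add, val_add, this]

theorem zero_add (A : LinePoint L h) : 0 + A = A := by
  refine Subtype.ext ?_
  rw [val_add, val_zero, translation_self]
  rfl

/-- The points of the line `OI` form a commutative group under addition. -/
noncomputable abbrev addCommGroup : AddCommGroup (LinePoint L h) where
  add_assoc := add_assoc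
  zero_add := zero_add
  add_zero A := (add_comm A 0).trans (zero_add A)
  add_comm := add_comm
  neg_add_cancel A := (add_comm _ _).trans (add_neg A)
  sub_eq_add_neg _ _ := rfl
  nsmul := nsmulRec
  zsmul := zsmulRec

/-- The constant map to `O` is not a dilatation, but `IsProd.eq_of_par` does not ask for
injectivity. -/
theorem zero_mul (A : LinePoint L h) : 0 * A = 0 :=
  Subtype.ext <| IsProd.eq_of_par (f := fun _ => O) h A.2 (fun _ _ => .right_self _ _ _) rfl rfl
    (Classical.choose_spec (exists_prod 0 A))

theorem exists_dilatation_mul {A : LinePoint L h} (hA : A ≠ 0) :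
    ∃ f : P → P, IsDilatation L f ∧ f O = O ∧ f I = A.1 :=
  exists_dilatation h.symm (fun e => hA (eq_zero_iff.2 e)) A.2

theorem val_mul {A : LinePoint L h} {f : P → P} (hf : IsDilatation L f) (hO : f O = O)
    (hI : f I = A.1) (B : LinePoint L h) : (A * B).1 = f B.1 :=
  IsProd.eq_of_par h B.2 hf.par hO hI (Classical.choose_spec (exists_prod A B))

theorem mul_zero (A : LinePoint L h) : A * 0 = 0 := by
  by_cases hA : A = 0
  · rw [hA, zero_mul]
  obtain ⟨f, hf, hO, hI⟩ := exists_dilatation_mul hA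
  exact Subtype.ext ((val_mul hf hO hI 0).trans hO)

theorem one_mul (A : LinePoint L h) : 1 * A = A :=
  Subtype.ext (val_mul (A := (1 : LinePoint L h)) .id rfl rfl A)

theorem mul_one (A : LinePoint L h) : A * 1 = A := by
  by_cases hA : A = 0
  · rw [hA, zero_mul]
  obtain ⟨f, hf, hO, hI⟩ := exists_dilatation_mul hA
  exact Subtype.ext ((val_mul hf hO hI 1).trans hI)

theorem mul_assoc (A B C : LinePoint L h) : A * B * C = A * (B * C) := by
  by_cases hA : A = 0
  · simp only [hA, zero_mul]
  by_cases hB : B = 0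
  · simp only [hB, zero_mul, mul_zero]
  obtain ⟨f, hf, hfO, hfI⟩ := exists_dilatation_mul hA
  obtain ⟨g, hg, hgO, hgI⟩ := exists_dilatation_mul hB
  refine Subtype.ext ?_
  rw [val_mul hf hfO hfI, val_mul hg hgO hgI]
  refine val_mul (hf.comp hg) ?_ ?_ C
  · rw [Function.comp_apply, hgO, hfO]
  · rw [Function.comp_apply, hgI, val_mul hf hfO hfI]

theorem mul_add (A B C : LinePoint L h) : A * (B + C) = A * B + A * C := by
  by_cases hA : A = 0
  · simp only [hA, zero_mul, zero_add]
  obtain ⟨f, hf, hO, hI⟩ := exists_dilatation_mul hA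
  refine Subtype.ext ?_
  rw [val_add, val_mul hf hO hI, val_mul hf hO hI, val_mul hf hO hI, val_add,
    hf.map_translation hO]

theorem mul_neg (A B : LinePoint L h) : A * -B = -(A * B) := by
  let _ : AddCommGroup (LinePoint L h) := addCommGroup
  refine eq_neg_of_add_eq_zero_right ?_
  rw [← mul_add, add_neg, mul_zero]

/-- The reflection in `O` is the dilatation that fixes `O` and sends `I` to `-1`. This replaces
right distributivity in `neg_mul`. -/
theorem neg_one_mul (A : LinePoint L h) : (-1) * A = -A := by
  obtain ⟨f, hf, hfX⟩ := exists_reflection L O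
  have key : ∀ A : LinePoint L h, f A.1 = (-A).1 := fun A =>
    (isTranslation_translation (L := L) O A.1).injective <|
      (hfX A.1).trans ((congrArg Subtype.val (add_neg A)).symm.trans (val_add A (-A)))
  refine Subtype.ext ((val_mul hf ?_ (key 1) A).trans (key A))
  have := hfX O
  rwa [translation_self] at this

theorem neg_mul (A B : LinePoint L h) : -A * B = -(A * B) := by
  rw [← neg_one_mul A, mul_assoc, neg_one_mul]

theorem one_ne_zero : (1 : LinePoint L h) ≠ 0 :=
  fun e => h (congrArg Subtype.val e).symm

theorem mul_inv_cancel {A : LinePoint L h} (hA : A ≠ 0) : A * A⁻¹ = 1 := by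
  have hA' : A.1 ≠ O := fun e => hA (eq_zero_iff.2 e)
  obtain ⟨f, hf, hO, hI⟩ := exists_dilatation_mul hA
  refine Subtype.ext ((val_mul hf hO hI _).trans (Eq.symm ?_))
  refine IsProd.eq_of_par h (A⁻¹).2 hf.par hO hI ?_
  have e : A⁻¹ = Classical.choose (exists_inverse A hA') := dif_pos hA'
  rw [e]
  exact Classical.choose_spec (exists_inverse A hA')

/-- The construction gives only a right inverse. It is nonzero, so it has a right inverse of its
own, and the usual group argument applies. -/
theorem inv_mul_cancel {A : LinePoint L h} (hA : A ≠ 0) : A⁻¹ * A = 1 := by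
  have hA' : A⁻¹ ≠ 0 := fun e => one_ne_zero (h := h) (by rw [← mul_inv_cancel hA, e, mul_zero])
  calc A⁻¹ * A = A⁻¹ * A * (A⁻¹ * (A⁻¹)⁻¹) := by rw [mul_inv_cancel hA', mul_one]
    _ = A⁻¹ * (A * A⁻¹) * (A⁻¹)⁻¹ := by simp only [mul_assoc]
    _ = 1 := by rw [mul_inv_cancel hA, mul_one, mul_inv_cancel hA']

theorem inv_neg_mul {A : LinePoint L h} (hA : A ≠ 0) (B : LinePoint L h) :
    (-A)⁻¹ * B = -(A⁻¹ * B) := by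
  let _ : AddCommGroup (LinePoint L h) := addCommGroup
  have hA' : -A ≠ 0 := neg_ne_zero.2 hA
  calc (-A)⁻¹ * B = (-A)⁻¹ * (-A * -(A⁻¹ * B)) := by
        rw [neg_mul A, mul_neg A, ← mul_assoc A, mul_inv_cancel hA, one_mul, neg_neg]
    _ = -(A⁻¹ * B) := by rw [← mul_assoc, inv_mul_cancel hA', one_mul]

end LinePoint

end AffineIncidencePlane

theorem mainTheorem3 {P L : Type*} [Membership P L] [DesarguesAffinePlane P L]
    {O I : P} (hOI : O ≠ I) (B C : LinePoint L hOI) (hBC : B ≠ C) :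
    Function.Bijective (LinePoint.ratioMap B C) ∧
      Function.LeftInverse (fun R => (B - C) * R + C) (LinePoint.ratioMap B C) ∧
      Function.RightInverse (fun R => (B - C) * R + C) (LinePoint.ratioMap B C) ∧
      ∀ X : LinePoint L hOI,
        LinePoint.ratioMap B C X = (B - C)⁻¹ * X + (C - B)⁻¹ * C := by
  let _ : AddCommGroup (LinePoint L hOI) := LinePoint.addCommGroup
  have hD : B - C ≠ 0 := sub_ne_zero.2 hBC
  have hl : Function.LeftInverse (fun R => (B - C) * R + C) (LinePoint.ratioMap B C) := by
    intro X
    change (B - C) * ((B - C)⁻¹ * (X - C)) + C = X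
    rw [← LinePoint.mul_assoc, LinePoint.mul_inv_cancel hD, LinePoint.one_mul, sub_add_cancel]
  have hr : Function.RightInverse (fun R => (B - C) * R + C) (LinePoint.ratioMap B C) := by
    intro R
    change (B - C)⁻¹ * ((B - C) * R + C - C) = R
    rw [add_sub_cancel_right, ← LinePoint.mul_assoc, LinePoint.inv_mul_cancel hD,
      LinePoint.one_mul]
  refine ⟨⟨hl.injective, hr.surjective⟩, hl, hr, fun X => ?_⟩
  have e : (C - B)⁻¹ * C = -((B - C)⁻¹ * C) := by
    rw [← LinePoint.inv_neg_mul hD, neg_sub]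
  rw [e, ← LinePoint.mul_neg, ← LinePoint.mul_add]
  rfl
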